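/- A formula of continuous logic in the language of C*-algebras is built from norms $\|p(x_1,\dots,x_n)\|$ of complex $*$-polynomials without constant term in noncommuting variables, by applying continuous functions $\mathbb{R}^k\to\mathbb{R}$ to finitely many formulae and by taking suprema and infima of a variable over the closed unit ball. A sentence $\varphi$ is a formula without free variables; its value in a C*-algebra $\mathcal{A}$ is a real number $\varphi^{\mathcal{A}}$. A (complex, not assumed unital) C*-algebra $\mathcal{A}$ is called pseudocompact if $\varphi^{\mathcal{A}}=0$ for every sentence $\varphi$ such that $\varphi^{\mathcal{F}}=0$ for all finite-dimensional C*-algebras $\mathcal{F}$. **Proposition 5.10.** Every pseudocompact C*-algebra $\mathcal{A}$ has the Dixmier property: $\mathcal{A}$ is unital and, for every $a\in\mathcal{A}$, $$\overline{\operatorname{conv}}\,\{\,uau^* : u\in\mathcal{U}(\mathcal{A})\,\}\cap Z(\mathcal{A})\neq\emptyset,$$ where the closure is in norm, $\mathcal{U}(\mathcal{A})$ is the unitary group and $Z(\mathcal{A})$ is the center of $\mathcal{A}$. -/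

import Mathlib

/-! ### Continuous logic for C*-algebras -/

/-- Complex `*`-polynomials without constant term in `n` noncommuting variables: the terms of the
language of C*-algebras (zero, addition, multiplication, complex scalars, adjoint). -/
inductive StarPoly (n : ℕ) : Type
  | var (i : Fin n) : StarPoly n
  | zero : StarPoly n
  | add (s t : StarPoly n) : StarPoly n
  | mul (s t : StarPoly n) : StarPoly n
  | smul (c : ℂ) (t : StarPoly n) : StarPoly n
  | adj (t : StarPoly n) : StarPoly n

/-- Formulae of the language of C*-algebras with free variables among `x₀, …, xₙ₋₁`.
Atomic formulae are norms of `*`-polynomials, connectives are continuous functions `ℝᵏ → ℝ`,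
and the quantifiers (which bind the last variable `xₙ`) are suprema and infima over the closed
unit ball. -/
inductive CStarFormula : ℕ → Type
  | norm {n : ℕ} (t : StarPoly n) : CStarFormula n
  | conn {n k : ℕ} (f : C(Fin k → ℝ, ℝ)) (φ : Fin k → CStarFormula n) : CStarFormula n
  | sup {n : ℕ} (φ : CStarFormula (n + 1)) : CStarFormula n
  | inf {n : ℕ} (φ : CStarFormula (n + 1)) : CStarFormula n

/-- A sentence is a formula without free variables. -/
abbrev CStarSentence : Type := CStarFormula 0

section Semantics

variable {A : Type*} [NonUnitalCStarAlgebra A]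

/-- The value of a `*`-polynomial at a tuple of elements of a C*-algebra. -/
def StarPoly.eval {n : ℕ} (v : Fin n → A) : StarPoly n → A
  | .var i => v i
  | .zero => 0
  | .add s t => s.eval v + t.eval v
  | .mul s t => s.eval v * t.eval v
  | .smul c t => c • t.eval v
  | .adj t => star (t.eval v)

/-- The value of a formula at a tuple of elements of the closed unit ball of a C*-algebra.
The suprema and infima are over bounded nonempty sets of reals, see
`CStarFormula.exists_forall_abs_eval_le`. -/
noncomputable def CStarFormula.eval : {n : ℕ} → CStarFormula n →
    (Fin n → Metric.closedBall (0 : A) 1) → ℝ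
  | _, .norm t, v => ‖t.eval (fun i => (v i : A))‖
  | _, .conn f φ, v => f (fun j => (φ j).eval v)
  | _, .sup φ, v => ⨆ x : Metric.closedBall (0 : A) 1, φ.eval (Fin.snoc v x)
  | _, .inf φ, v => ⨅ x : Metric.closedBall (0 : A) 1, φ.eval (Fin.snoc v x)

end Semantics

/-- The value `φ^A` of a sentence `φ` in a C*-algebra `A`. -/
noncomputable def CStarSentence.value (φ : CStarSentence) (A : Type*) [NonUnitalCStarAlgebra A] :
    ℝ :=
  CStarFormula.eval (A := A) φ Fin.elim0

/-- A C*-algebra `A` (not assumed to be unital) is pseudocompact if every sentence of the language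
of C*-algebras that has the value zero in all finite-dimensional C*-algebras has the value zero
in `A`.  (Values of sentences are invariant under `*`-isomorphisms, and every finite-dimensional
C*-algebra is `*`-isomorphic to one in the lowest universe.) -/
def IsPseudocompact (A : Type*) [NonUnitalCStarAlgebra A] : Prop :=
  ∀ φ : CStarSentence,
    (∀ (F : Type) [NonUnitalCStarAlgebra F] [FiniteDimensional ℂ F], φ.value F = 0) →
      φ.value A = 0

/-! ### The Dixmier property -/

/-- The unitary orbit of `a` in a C*-algebra with identity element `e`. -/
def unitaryOrbit {A : Type*} [NonUnitalCStarAlgebra A] (e a : A) : Set A :=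
  {x | ∃ u : A, star u * u = e ∧ u * star u = e ∧ x = u * a * star u}

/-- A C*-algebra `A` has the Dixmier property if it has an identity element and, for every
`a : A`, the norm-closed convex hull of the unitary orbit of `a` meets the center of `A`. -/
def DixmierProperty (A : Type*) [NonUnitalCStarAlgebra A] : Prop :=
  ∃ e : A, (∀ x : A, e * x = x ∧ x * e = x) ∧
    ∀ a : A, (closure (convexHull ℝ (unitaryOrbit e a)) ∩ Set.center A).Nonempty

/-! ### Checks of the definitions -/

/-- For unital C*-algebras in the sense of Mathlib, the Dixmier property is the usual one. -/
theorem dixmierProperty_iff (A : Type*) [CStarAlgebra A] :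
    DixmierProperty A ↔ ∀ a : A,
      (closure (convexHull ℝ (Set.range fun u : unitary A => (u : A) * a * star (u : A))) ∩
        Set.center A).Nonempty := by
  have key : ∀ a : A, unitaryOrbit 1 a =
      Set.range fun u : unitary A => (u : A) * a * star (u : A) := by
    intro a
    ext x
    constructor
    · rintro ⟨u, h1, h2, rfl⟩
      exact ⟨⟨u, Unitary.mem_iff.mpr ⟨h1, h2⟩⟩, rfl⟩
    · rintro ⟨u, rfl⟩
      exact ⟨u, Unitary.coe_star_mul_self u, Unitary.coe_mul_star_self u, rfl⟩
  constructor
  · rintro ⟨e, he, h⟩ a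
    have : e = 1 := by simpa using (he 1).1
    subst this
    simpa only [key] using h a
  · intro h
    exact ⟨1, fun x => ⟨one_mul x, mul_one x⟩, fun a => by simpa only [key] using h a⟩

/-- The values of a `*`-polynomial on unit balls are bounded, uniformly over all C*-algebras. -/
theorem StarPoly.exists_forall_norm_eval_le {n : ℕ} (t : StarPoly n) :
    ∃ C : ℝ, ∀ (A : Type*) [NonUnitalCStarAlgebra A]
      (v : Fin n → Metric.closedBall (0 : A) 1), ‖t.eval (fun i => (v i : A))‖ ≤ C := by
  induction t with
  | var i => exact ⟨1, fun A _ v => mem_closedBall_zero_iff.mp (v i).2⟩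
  | zero => exact ⟨0, fun A _ v => by simp [StarPoly.eval]⟩
  | add s t hs ht =>
    obtain ⟨C, hC⟩ := hs
    obtain ⟨D, hD⟩ := ht
    exact ⟨C + D, fun A _ v => (norm_add_le _ _).trans (add_le_add (hC A v) (hD A v))⟩
  | mul s t hs ht =>
    obtain ⟨C, hC⟩ := hs
    obtain ⟨D, hD⟩ := ht
    exact ⟨C * D, fun A _ v => (norm_mul_le _ _).trans
      (mul_le_mul (hC A v) (hD A v) (norm_nonneg _) ((norm_nonneg _).trans (hC A v)))⟩
  | smul c t ht =>
    obtain ⟨C, hC⟩ := ht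
    exact ⟨‖c‖ * C, fun A _ v => by
      simpa [StarPoly.eval, norm_smul] using
        mul_le_mul_of_nonneg_left (hC A v) (norm_nonneg c)⟩
  | adj t ht =>
    obtain ⟨C, hC⟩ := ht
    exact ⟨C, fun A _ v => by simpa [StarPoly.eval] using hC A v⟩

/-- The values of a formula are bounded, uniformly over all C*-algebras; hence the suprema and
infima in `CStarFormula.eval` are genuine. -/
theorem CStarFormula.exists_forall_abs_eval_le {n : ℕ} (φ : CStarFormula n) :
    ∃ C : ℝ, ∀ (A : Type*) [NonUnitalCStarAlgebra A]
      (v : Fin n → Metric.closedBall (0 : A) 1), |φ.eval v| ≤ C := by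
  induction φ with
  | norm t =>
    obtain ⟨C, hC⟩ := t.exists_forall_norm_eval_le
    exact ⟨C, fun A _ v => by simpa [CStarFormula.eval] using hC A v⟩
  | conn f φ ih =>
    choose C hC using ih
    have hK : IsCompact (Set.univ.pi fun j => Set.Icc (-C j) (C j)) :=
      isCompact_univ_pi fun j => isCompact_Icc
    obtain ⟨D, hD⟩ := hK.exists_bound_of_continuousOn f.continuous.continuousOn
    exact ⟨D, fun A _ v => by
      simpa [CStarFormula.eval] using hD _ fun j _ => abs_le.mp (hC j A v)⟩
  | sup φ ih =>
    obtain ⟨C, hC⟩ := ih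
    refine ⟨C, fun A _ v => ?_⟩
    have : Nonempty (Metric.closedBall (0 : A) 1) := ⟨⟨0, by simp⟩⟩
    have hb : BddAbove (Set.range fun x : Metric.closedBall (0 : A) 1 =>
        φ.eval (Fin.snoc v x : Fin _ → Metric.closedBall (0 : A) 1)) :=
      ⟨C, by rintro _ ⟨x, rfl⟩; exact (abs_le.mp (hC A _)).2⟩
    exact abs_le.mpr ⟨(abs_le.mp (hC A _)).1.trans (le_ciSup hb ⟨0, by simp⟩),
      ciSup_le fun x => (abs_le.mp (hC A _)).2⟩
  | inf φ ih =>
    obtain ⟨C, hC⟩ := ih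
    refine ⟨C, fun A _ v => ?_⟩
    have : Nonempty (Metric.closedBall (0 : A) 1) := ⟨⟨0, by simp⟩⟩
    have hb : BddBelow (Set.range fun x : Metric.closedBall (0 : A) 1 =>
        φ.eval (Fin.snoc v x : Fin _ → Metric.closedBall (0 : A) 1)) :=
      ⟨-C, by rintro _ ⟨x, rfl⟩; exact (abs_le.mp (hC A _)).1⟩
    exact abs_le.mpr ⟨le_ciInf fun x => (abs_le.mp (hC A _)).1,
      (ciInf_le hb ⟨0, by simp⟩).trans (abs_le.mp (hC A _)).2⟩

/-!
A finite-dimensional C*-algebra satisfies Dixmier's averaging lemma with a constant that does not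
depend on the algebra: for a self-adjoint contraction `h` there are a unitary `u` and a central
contraction `z` with `‖(h + u h u*) / 2 - z‖ ≤ 3 / 4` (`exists_unitary_central_norm_le`). The proof
compares the positive and the negative spectral projection of `h` by a maximal partial isometry
(`exists_partialIsometry_maximal`) and separates what is left over by a central projection
(`exists_central_separating`), so that the classification of finite-dimensional C*-algebras is not
needed.

Because of the uniformity, this lemma, like the existence of an identity, is the vanishing of one
sentence of continuous logic (`unitSentence`, `averagingSentence`), and so it holds approximately in
a pseudocompact algebra `A`: there is an identity (`IsPseudocompact.exists_unit`), and `u` is a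
unitary up to a small perturbation (`exists_unitary_norm_sub_le`), but `z` is only almost central,
i.e. its commutators with the unit ball are small.

Almost centrality suffices. Iterating the averaging step, first on the real and then on the imaginary
part of `a`, gives a composition `T` of averages `x ↦ (x + u x u*) / 2` for which `T a` is as close to
central as desired (`IsPseudocompact.exists_mixing_mem_almostCenter`). Any further such averaging
hardly moves `T a` (`norm_apply_sub_le_of_mem_mixing`), so repeating the procedure produces a Cauchy
sequence in the convex hull of the unitary orbit of `a`, whose limit is central.
-/

open Filter Topology

/-! ### Finite-dimensional C*-algebras -/

/-- A cluster point of an approximate unit in the compact unit ball is an identity element. -/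
theorem NonUnitalCStarAlgebra.exists_unit_of_finiteDimensional (F : Type*)
    [NonUnitalCStarAlgebra F] [FiniteDimensional ℂ F] :
    ∃ e : F, ∀ x : F, e * x = x ∧ x * e = x := by
  let _ : PartialOrder F := CStarAlgebra.spectralOrder F
  have _ : StarOrderedRing F := CStarAlgebra.spectralOrderedRing F
  have : ProperSpace F := FiniteDimensional.proper ℂ F
  have hl := CStarAlgebra.increasingApproximateUnit F
  set l := CStarAlgebra.approximateUnit F
  have := hl.neBot
  obtain ⟨e, -, he⟩ := (isCompact_closedBall (0 : F) 1).exists_clusterPt (f := l)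
    (le_principal_iff.mpr (by
      filter_upwards [hl.eventually_norm] with x hx using mem_closedBall_zero_iff.mpr hx))
  have : (𝓝 e ⊓ l).NeBot := he
  refine ⟨e, fun x => ⟨?_, ?_⟩⟩
  · exact tendsto_nhds_unique (f := fun y => y * x) (l := 𝓝 e ⊓ l)
      (((continuous_mul_const x).tendsto e).mono_left inf_le_left)
      ((hl.tendsto_mul_right x).mono_left inf_le_right)
  · exact tendsto_nhds_unique (f := fun y => x * y) (l := 𝓝 e ⊓ l)
      (((continuous_const_mul x).tendsto e).mono_left inf_le_left)
      ((hl.tendsto_mul_left x).mono_left inf_le_right)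

/-- A C*-algebra with an identity element `e`, as a unital C*-algebra whose other operations are
definitionally the given ones. -/
@[reducible]
noncomputable def CStarAlgebra.ofUnit {F : Type*} [i : NonUnitalCStarAlgebra F] (e : F)
    (he : ∀ x : F, e * x = x ∧ x * e = x) : CStarAlgebra F :=
  let _ : NormedRing F :=
    { i with
      one := e
      one_mul := fun x => (he x).1
      mul_one := fun x => (he x).2 }
  { i with
    toNormedRing := inferInstance
    toNormedAlgebra :=
      { Algebra.ofModule (R := ℂ) (A := F) smul_mul_assoc mul_smul_comm with
        norm_smul_le := norm_smul_le }}

/-- In particular every real function is continuous on the spectrum, so that the continuous functional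
calculus applies to it. -/
theorem finite_spectrum_real_of_finiteDimensional {B : Type*} [CStarAlgebra B]
    [FiniteDimensional ℂ B] (x : B) : (spectrum ℝ x).Finite := by
  have : FiniteDimensional ℝ B := FiniteDimensional.trans ℝ ℂ B
  by_cases h : Nontrivial B
  · have hx : IsIntegral ℝ x := Algebra.IsIntegral.isIntegral x
    refine ((minpoly ℝ x).rootSet_finite ℝ).subset fun t ht => ?_
    have := spectrum.subset_polynomial_aeval x (minpoly ℝ x) ⟨t, ht, rfl⟩
    rw [minpoly.aeval, spectrum.zero_eq] at this
    rw [Polynomial.mem_rootSet]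
    exact ⟨minpoly.ne_zero hx, by simpa using this⟩
  · have := not_nontrivial_iff_subsingleton.mp h
    simp

theorem CStarAlgebra.norm_le_of_neg_le_of_le {B : Type*} [CStarAlgebra B] [PartialOrder B]
    [StarOrderedRing B] {b : B} {r : ℝ} (hr : 0 ≤ r) (hb : IsSelfAdjoint b)
    (h1 : -algebraMap ℝ B r ≤ b) (h2 : b ≤ algebraMap ℝ B r) : ‖b‖ ≤ r := by
  by_cases h : Nontrivial B
  · rw [le_algebraMap_iff_spectrum_le hb] at h2
    rw [← map_neg, algebraMap_le_iff_le_spectrum hb] at h1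
    rcases CStarAlgebra.norm_or_neg_norm_mem_spectrum hb with h | h
    · exact h2 _ h
    · linarith [h1 _ h]
  · have := not_nontrivial_iff_subsingleton.mp h
    simpa [Subsingleton.elim b 0] using hr

/-- Every nonzero `y` yields a nonzero partial isometry `w = y r (y* y)`, the partial isometry of its
polar decomposition. The form of `w` shows that it inherits the relations `q y = y` and `y p = y`. -/
theorem exists_partialIsometry_of_ne_zero {B : Type*} [CStarAlgebra B]
    [FiniteDimensional ℂ B] {y : B} (hy : y ≠ 0) :
    ∃ r : B, y * (r * (star y * y)) ≠ 0 ∧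
      y * (r * (star y * y)) * star (y * (r * (star y * y))) * (y * (r * (star y * y))) =
        y * (r * (star y * y)) := by
  let _ : PartialOrder B := CStarAlgebra.spectralOrder B
  have _ : StarOrderedRing B := CStarAlgebra.spectralOrderedRing B
  set h := star y * y with hh
  have hsa : IsSelfAdjoint h := IsSelfAdjoint.star_mul_self y
  have h0 : 0 ≤ h := star_mul_self_nonneg y
  have hspec : ∀ t ∈ spectrum ℝ h, 0 ≤ t := fun t ht => spectrum_nonneg_of_nonneg h0 ht
  have hc : ∀ f : ℝ → ℝ, ContinuousOn f (spectrum ℝ h) := fun f =>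
    (finite_spectrum_real_of_finiteDimensional h).continuousOn f
  set g : ℝ → ℝ := fun t => (√t)⁻¹ * t⁻¹ with hg
  -- `g t * t` is `1 / √t` for `t > 0` and `0` at `t = 0`, by the convention for inverses
  refine ⟨cfc g h, ?_⟩
  set k := cfc g h * h with hk
  have hmul : ∀ f₁ f₂ : ℝ → ℝ, cfc f₁ h * cfc f₂ h = cfc (fun t => f₁ t * f₂ t) h :=
    fun f₁ f₂ => (cfc_mul f₁ f₂ h (hc _) (hc _)).symm
  have hid : cfc (fun t : ℝ => t) h = h := cfc_id' ℝ h hsa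
  have hk' : k = cfc (fun t => g t * t) h := by
    rw [← hmul, hid]
  have hks : star k = k := by rw [hk']; exact (cfc_predicate (p := IsSelfAdjoint) _ h)
  have hkhk : k * h * k = cfc (fun t => g t * t * t * (g t * t)) h := by
    calc k * h * k = cfc (fun t => g t * t) h * cfc (fun t : ℝ => t) h *
          cfc (fun t => g t * t) h := by rw [hid, hk']
      _ = _ := by rw [hmul, hmul]
  have hgt : ∀ t : ℝ, 0 < t → g t * t * t * (g t * t) = 1 := fun t ht => by
    have h2 : √t ^ 2 = t := Real.sq_sqrt ht.le
    have h3 : √t ≠ 0 := (Real.sqrt_pos.mpr ht).ne'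
    simp only [hg]
    field_simp
    exact h2.symm
  have e1 : star (y * k) * (y * k) = k * h * k := by
    rw [star_mul, hks, hh]; simp only [mul_assoc]
  have e2 : k * h * k * h = h := by
    have : k * h * k * h = cfc (fun t => g t * t * t * (g t * t)) h * cfc (fun t : ℝ => t) h := by
      rw [hid, hkhk]
    rw [this, hmul]
    refine (cfc_congr fun t ht => ?_).trans hid
    rcases (hspec t ht).eq_or_lt with rfl | ht
    · simp
    · simp only [hgt t ht, one_mul]
  have hkk : k * (k * h * k) = k := by
    rw [hkhk, hk', hmul]
    refine cfc_congr fun t ht => ?_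
    rcases (hspec t ht).eq_or_lt with rfl | ht
    · simp
    · simp only [hgt t ht, mul_one]
  refine ⟨fun hz => ?_, ?_⟩
  · rw [hz, mul_zero] at e1
    rw [← e1, zero_mul] at e2
    exact hy (CStarRing.star_mul_self_eq_zero_iff y |>.mp e2.symm)
  · rw [mul_assoc, e1, mul_assoc, hkk]

/-! ### Comparison of projections -/

section Comparison

variable {B : Type*} [CStarAlgebra B] [FiniteDimensional ℂ B]

/-- Comparison of projections: a partial isometry `v` from a subprojection of `p` onto a subprojection
of `q` that cannot be extended, in the sense that nothing is left between `p - v* v` and `q - v v*`. -/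
theorem exists_partialIsometry_maximal (p q : B) (hp : p * p = p) (hp' : star p = p)
    (hq : q * q = q) (hq' : star q = q) :
    ∃ v : B, q * v = v ∧ v * p = v ∧ v * star v * v = v ∧
      ∀ x : B, (q - v * star v) * x * (p - star v * v) = 0 := by
  let S : Set B := {v | q * v = v ∧ v * p = v ∧ v * star v * v = v}
  have h0 : (0 : B) ∈ S := by simp [S]
  -- extending `v` makes the kernel of `x ↦ v x` smaller, so a minimal kernel gives a maximal `v`
  let K : B → Submodule ℂ B := fun v => LinearMap.ker (LinearMap.mulLeft ℂ v)
  obtain ⟨_, ⟨v, ⟨h1, h2, h3⟩, rfl⟩, hmin⟩ :=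
    WellFounded.has_min (wellFounded_lt (α := Submodule ℂ B)) (K '' S) ⟨_, 0, h0, rfl⟩
  refine ⟨v, h1, h2, h3, fun x => ?_⟩
  by_contra hy
  have h1' : star v * q = star v := by simpa [hq'] using congrArg star h1
  have h2' : p * star v = star v := by simpa [hp'] using congrArg star h2
  have h3' : star v * v * star v = star v := by simpa [mul_assoc] using congrArg star h3
  set q₀ := q - v * star v with hq₀
  set p₀ := p - star v * v with hp₀
  have hq₀q : q * q₀ = q₀ := by rw [hq₀, mul_sub, hq, ← mul_assoc, h1]
  have hp₀p : p₀ * p = p₀ := by rw [hp₀, sub_mul, hp, mul_assoc, h2]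
  have hvq₀ : star v * q₀ = 0 := by rw [hq₀, mul_sub, h1', ← mul_assoc, h3', sub_self]
  have hvp₀ : v * p₀ = 0 := by rw [hp₀, mul_sub, h2, ← mul_assoc, h3, sub_self]
  have hp₀s : star p₀ = p₀ := by simp [hp₀, hp']
  obtain ⟨r, hr0, hr⟩ := exists_partialIsometry_of_ne_zero hy
  -- a partial isometry `w` inside `q₀ B p₀` would extend `v` to `v + w`
  set w := q₀ * x * p₀ * (r * (star (q₀ * x * p₀) * (q₀ * x * p₀))) with hw
  have hw1 : w = q₀ * (x * p₀ * (r * (star (q₀ * x * p₀) * (q₀ * x * p₀)))) := by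
    simp only [hw, mul_assoc]
  have hw2 : w = (q₀ * x * p₀ * (r * (star (q₀ * x * p₀) * (q₀ * x)))) * p₀ := by
    simp only [hw, mul_assoc]
  have hqw : q * w = w := by rw [hw1, ← mul_assoc, hq₀q]
  have hwp : w * p = w := by rw [hw2, mul_assoc, hp₀p]
  have hvw : star v * w = 0 := by rw [hw1, ← mul_assoc, hvq₀, zero_mul]
  have hvw' : v * star w = 0 := by rw [hw2, star_mul, hp₀s, ← mul_assoc, hvp₀, zero_mul]
  have hwv : star w * v = 0 := by simpa using congrArg star hvw
  have hwv' : w * star v = 0 := by simpa using congrArg star hvw'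
  have hmem : v + w ∈ S := by
    refine ⟨by rw [mul_add, h1, hqw], by rw [add_mul, h2, hwp], ?_⟩
    have hvvw : v * star v * w = 0 := by rw [mul_assoc, hvw, mul_zero]
    have hwwv : w * star w * v = 0 := by rw [mul_assoc, hwv, mul_zero]
    simp only [star_add, add_mul, mul_add, hvw', hwv', hvvw, hwwv, add_zero, zero_add,
      h3, hr]
  refine hmin _ ⟨_, hmem, rfl⟩ (lt_of_le_of_ne (fun z hz => ?_) fun heq => ?_)
  · have hz' : (v + w) * z = 0 := hz
    change v * z = 0
    calc v * z = v * (star v * ((v + w) * z)) := by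
          rw [← mul_assoc (star v), mul_add, hvw, add_zero, ← mul_assoc, ← mul_assoc, h3]
      _ = 0 := by rw [hz', mul_zero, mul_zero]
  · have hz : star w ∈ K v := hvw'
    rw [← heq] at hz
    have hz' : (v + w) * star w = 0 := hz
    rw [add_mul, hvw', zero_add, CStarRing.mul_star_self_eq_zero_iff] at hz'
    exact hr0 hz'

/-- If `q₀ B p₀ = 0`, then a central projection separates `p₀` from
`q₀`: it is the complement of the identity of the annihilator ideal `{x | x B p₀ = 0}`. -/
theorem exists_central_separating (p₀ q₀ : B) (h : ∀ x : B, q₀ * x * p₀ = 0) :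
    ∃ c : B, (∀ x, c * x = x * c) ∧ star c = c ∧ c * c = c ∧ c * p₀ = p₀ ∧ c * q₀ = 0 := by
  let J : NonUnitalStarSubalgebra ℂ B :=
    { carrier := {x | ∀ y, x * y * p₀ = 0}
      add_mem' := fun ha hb y => by rw [add_mul, add_mul, ha, hb, add_zero]
      zero_mem' := fun y => by simp
      mul_mem' := fun {a b} ha hb y => by rw [mul_assoc, mul_assoc, ← mul_assoc b, hb, mul_zero]
      smul_mem' := fun c x hx y => by rw [smul_mul_assoc, smul_mul_assoc, hx, smul_zero]
      star_mem' := fun {x} hx y => by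
        -- `z = x* y p₀` vanishes since `z* z` contains the factor `x (x* y) p₀`
        rw [← CStarRing.star_mul_self_eq_zero_iff]
        have := hx (star x * y)
        calc star (star x * y * p₀) * (star x * y * p₀)
            = star p₀ * star y * (x * (star x * y) * p₀) := by simp [mul_assoc]
          _ = 0 := by rw [this, mul_zero] }
  have hJl : ∀ (x : B) {y : B}, y ∈ J → x * y ∈ J := fun x y hy z => by
    rw [mul_assoc, mul_assoc, ← mul_assoc y, hy, mul_zero]
  have hJr : ∀ (x : B) {y : B}, y ∈ J → y * x ∈ J := fun x y hy z => by
    rw [mul_assoc y, hy]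
  have : IsClosed (J : Set B) := J.toSubmodule.closed_of_finiteDimensional
  have : FiniteDimensional ℂ J := inferInstanceAs (FiniteDimensional ℂ J.toSubmodule)
  obtain ⟨⟨f, hf⟩, hfu⟩ := NonUnitalCStarAlgebra.exists_unit_of_finiteDimensional J
  have hfl : ∀ x ∈ J, f * x = x := fun x hx => congrArg Subtype.val (hfu ⟨x, hx⟩).1
  have hfr : ∀ x ∈ J, x * f = x := fun x hx => congrArg Subtype.val (hfu ⟨x, hx⟩).2
  have hfs : star f = f := by
    have := congrArg star (hfl _ (star_mem hf))
    rw [star_mul, star_star, hfl _ (star_mem hf)] at this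
    exact this
  have hfc : ∀ x, f * x = x * f := fun x => by
    rw [← hfr _ (hJr x hf), mul_assoc, hfl _ (hJl x hf)]
  refine ⟨1 - f, fun x => by rw [sub_mul, mul_sub, hfc, one_mul, mul_one], by simp [hfs], ?_, ?_, ?_⟩
  · simp [sub_mul, mul_sub, hfl f hf]
  · rw [sub_mul, one_mul, sub_eq_self]
    simpa using hf 1
  · rw [sub_mul, one_mul, hfl _ h, sub_self]

end Comparison

/-! ### Dixmier's averaging lemma -/

section Averaging

variable {B : Type*} [CStarAlgebra B] [FiniteDimensional ℂ B]

/-- The projection `p` is the spectral projection of `a` for `[0, 1]`; the inequalities say that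
`0 ≤ a p ≤ p` and `-(1 - p) ≤ a (1 - p) ≤ 0`. -/
theorem exists_spectral_splitting [PartialOrder B] [StarOrderedRing B] (a : B)
    (ha : IsSelfAdjoint a) (h1 : ‖a‖ ≤ 1) :
    ∃ p : B, p * p = p ∧ star p = p ∧ 0 ≤ a * p ∧ 0 ≤ p - a * p ∧ 0 ≤ -(a * (1 - p)) ∧
      0 ≤ (1 - p) + a * (1 - p) := by
  have hc : ∀ f : ℝ → ℝ, ContinuousOn f (spectrum ℝ a) := fun f =>
    (finite_spectrum_real_of_finiteDimensional a).continuousOn f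
  have hmul : ∀ f₁ f₂ : ℝ → ℝ, cfc f₁ a * cfc f₂ a = cfc (fun t => f₁ t * f₂ t) a :=
    fun f₁ f₂ => (cfc_mul f₁ f₂ a (hc _) (hc _)).symm
  have hsub : ∀ f₁ f₂ : ℝ → ℝ, cfc f₁ a - cfc f₂ a = cfc (fun t => f₁ t - f₂ t) a :=
    fun f₁ f₂ => (cfc_sub f₁ f₂ a (hc _) (hc _)).symm
  have hid : cfc (fun t : ℝ => t) a = a := cfc_id' ℝ a ha
  have hone : cfc (fun _ : ℝ => (1 : ℝ)) a = 1 := cfc_const_one ℝ a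
  have hspec : ∀ t ∈ spectrum ℝ a, |t| ≤ 1 := fun t ht => by
    by_cases hn : Nontrivial B
    · exact (spectrum.norm_le_norm_of_mem ht).trans h1
    · have := not_nontrivial_iff_subsingleton.mp hn
      simp at ht
  set g : ℝ → ℝ := fun t => if 0 ≤ t then 1 else 0 with hg
  have hap : a * cfc g a = cfc (fun t => t * g t) a := by rw [← hmul, hid]
  have haq : a * (1 - cfc g a) = cfc (fun t => t * (1 - g t)) a := by
    rw [← hmul, ← hsub, hid, hone]
  have hq : 1 - cfc g a = cfc (fun t => 1 - g t) a := by rw [← hsub, hone]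
  refine ⟨cfc g a, ?_, cfc_predicate (p := IsSelfAdjoint) g a, ?_, ?_, ?_, ?_⟩
  · rw [hmul]
    congr 1
    ext t
    by_cases h : 0 ≤ t <;> simp [hg, h]
  · rw [hap]
    refine cfc_nonneg fun t ht => ?_
    by_cases h : 0 ≤ t <;> simp [hg, h]
  · rw [hap, hsub]
    refine cfc_nonneg fun t ht => ?_
    have := (abs_le.mp (hspec t ht)).2
    by_cases h : 0 ≤ t <;> simp [hg, h, this]
  · rw [haq, ← cfc_neg]
    refine cfc_nonneg fun t ht => ?_
    by_cases h : 0 ≤ t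
    · simp [hg, h]
    · simp [hg, h, (not_le.mp h).le]
  · rw [haq, hq, ← cfc_add _ _ _ (hc _) (hc _)]
    refine cfc_nonneg fun t ht => ?_
    have := (abs_le.mp (hspec t ht)).1
    by_cases h : 0 ≤ t
    · simp [hg, h]
    · simp [hg, h]; linarith

/-- Dixmier's lemma for finite-dimensional C*-algebras, with a constant that does not depend on the
algebra. With `p` the projection of the splitting of `a` and `v` a maximal partial isometry from `p`
to `1 - p`, the unitary `u = v + v* + (1 - v* v - v v*)` exchanges `v* v` and `v v*`. On the central
summand `c`, where `v v* = 1 - p`, this gives `-1 ≤ a + u a u* ≤ 2`; on the summand `1 - c`, where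
`v* v = p`, it gives `-2 ≤ a + u a u* ≤ 1`. -/
theorem exists_unitary_central_norm_le (a : B) (ha : IsSelfAdjoint a) (h1 : ‖a‖ ≤ 1) :
    ∃ u z : B, star u * u = 1 ∧ u * star u = 1 ∧ (∀ x, z * x = x * z) ∧ ‖z‖ ≤ 1 ∧
      ‖(1 / 2 : ℂ) • (a + u * a * star u) - z‖ ≤ 3 / 4 := by
  let _ : PartialOrder B := CStarAlgebra.spectralOrder B
  have _ : StarOrderedRing B := CStarAlgebra.spectralOrderedRing B
  obtain ⟨p, hp, hps, hap, hpap, haq, hqaq⟩ := exists_spectral_splitting a ha h1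
  obtain ⟨v, hqv, hvp, hvv, hmax⟩ := exists_partialIsometry_maximal p (1 - p) hp hps
    (by simp [mul_sub, sub_mul, hp]) (by simp [hps])
  obtain ⟨c, hcc, hcs, hci, hcp, hcq⟩ := exists_central_separating _ _ hmax
  set s := star v with hs
  have hss : star s = v := star_star v
  -- multiplication table of `p`, `v`, `s = v*`
  have r1 : p * v = 0 := by simpa [sub_mul] using hqv
  have r2 : s * p = 0 := by simpa [hps] using congrArg star r1
  have r3 : p * s = s := by simpa [hps] using congrArg star hvp
  have r4 : v * v = 0 := by
    calc v * v = v * (p * v) := by rw [← mul_assoc, hvp]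
      _ = 0 := by rw [r1, mul_zero]
  have r5 : s * s = 0 := by simpa using congrArg star r4
  have r6 : v * (s * v) = v := by rw [← mul_assoc, hvv]
  have r7 : s * (v * s) = s := by simpa [hss, ← hs] using congrArg star hvv
  have r1' : ∀ x, p * (v * x) = 0 := fun x => by rw [← mul_assoc, r1, zero_mul]
  have r3' : ∀ x, p * (s * x) = s * x := fun x => by rw [← mul_assoc, r3]
  have r4' : ∀ x, v * (v * x) = 0 := fun x => by rw [← mul_assoc, r4, zero_mul]
  have r5' : ∀ x, s * (s * x) = 0 := fun x => by rw [← mul_assoc, r5, zero_mul]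
  -- the parts of `p` and `1 - p` not exchanged by `u`; they are separated by `c`
  set p₀ := p - s * v with hp₀
  set q₀ := 1 - p - v * s with hq₀
  have hp₀p : IsStarProjection p₀ := by
    refine ⟨?_, ?_⟩
    · change p₀ * p₀ = p₀
      simp only [hp₀, mul_sub, sub_mul, mul_assoc, hp, r6, r3', hvp]
      abel
    · change star p₀ = p₀
      simp [hp₀, hps, hss, ← hs]
  have hq₀p : IsStarProjection q₀ := by
    refine ⟨?_, ?_⟩
    · change q₀ * q₀ = q₀
      simp only [hq₀, mul_sub, sub_mul, mul_assoc, hp, r2, r7, r1', mul_one, one_mul, mul_zero]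
      abel
    · change star q₀ = q₀
      simp [hq₀, hps, hss, ← hs]
  have hcp' : p₀ * c = p₀ := by rw [← hcc, hcp]
  have hcq' : q₀ * c = 0 := by rw [← hcc, hcq]
  have hcp₀ : IsStarProjection (c - p₀) := by
    refine ⟨?_, ?_⟩
    · change (c - p₀) * (c - p₀) = c - p₀
      have : p₀ * p₀ = p₀ := hp₀p.1
      simp [mul_sub, sub_mul, hci, hcp, hcp', this]
    · change star (c - p₀) = c - p₀
      rw [star_sub, hcs, hp₀p.2.star_eq]
  have hcq₀ : IsStarProjection (1 - c - q₀) := by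
    refine ⟨?_, ?_⟩
    · change (1 - c - q₀) * (1 - c - q₀) = 1 - c - q₀
      have : q₀ * q₀ = q₀ := hq₀p.1
      simp [mul_sub, sub_mul, hci, hcq, hcq', this]
    · change star (1 - c - q₀) = 1 - c - q₀
      rw [star_sub, star_sub, star_one, hcs, hq₀p.2.star_eq]
  set u := v + s + (1 - s * v - v * s) with hu
  have hus : star u = u := by
    simp only [hu, star_add, star_sub, star_mul, star_one, hss, ← hs]
    abel
  have huu : u * u = 1 := by
    simp only [hu, mul_sub, sub_mul, mul_add, add_mul, mul_assoc, r4, r5, r6, r7,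
      r4', r5', mul_one, one_mul, mul_zero]
    abel
  have hupu : u * p * u = v * s + p₀ := by
    simp only [hu, hp₀, mul_sub, sub_mul, mul_add, add_mul, mul_assoc, r1, r2, r3, r4, r6, r7,
      r1', r3', r4', hvp, mul_one, one_mul, mul_zero]
    abel
  have hconj : ∀ {x : B}, 0 ≤ x → 0 ≤ u * x * u := fun {x} hx => by
    simpa [hus] using star_left_conjugate_nonneg hx u
  have hT : IsSelfAdjoint (a + u * a * u) := by
    change star (a + u * a * u) = _
    rw [star_add, star_mul, star_mul, ha.star_eq, hus, mul_assoc]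
  have hupper : a + u * a * u ≤ 1 + c := by
    rw [← sub_nonneg]
    have : 1 + c - (a + u * a * u) = (p - a * p) + u * (p - a * p) * u + (-(a * (1 - p))) +
        u * (-(a * (1 - p))) * u + q₀ + (c - p₀) := by
      have : u * (p - a * p) * u + u * (-(a * (1 - p))) * u = u * p * u - u * a * u := by
        noncomm_ring
      rw [add_right_comm (p - a * p), add_assoc (p - a * p + _), this, hupu, hq₀]
      noncomm_ring
    rw [this]
    exact add_nonneg (add_nonneg (add_nonneg (add_nonneg (add_nonneg hpap (hconj hpap)) haq)
      (hconj haq)) hq₀p.nonneg) hcp₀.nonneg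
  have hlower : c - 1 - 1 ≤ a + u * a * u := by
    rw [← sub_nonneg]
    have : a + u * a * u - (c - 1 - 1) = a * p + u * (a * p) * u + ((1 - p) + a * (1 - p)) +
        u * ((1 - p) + a * (1 - p)) * u + p₀ + (1 - c - q₀) := by
      have : u * (a * p) * u + u * ((1 - p) + a * (1 - p)) * u
          = u * u - u * p * u + u * a * u := by
        noncomm_ring
      rw [add_right_comm (a * p), add_assoc (a * p + _), this, hupu, huu, hq₀]
      noncomm_ring
    rw [this]
    exact add_nonneg (add_nonneg (add_nonneg (add_nonneg (add_nonneg hap (hconj hap)) hqaq)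
      (hconj hqaq)) hp₀p.nonneg) hcq₀.nonneg
  have hc0 : 0 ≤ c := (show IsStarProjection c from ⟨hci, hcs⟩).nonneg
  have hc1 : 0 ≤ 1 - c := by simpa using add_nonneg hcq₀.nonneg hq₀p.nonneg
  have hsmul : ∀ (r : ℝ) {x : B}, 0 ≤ r → 0 ≤ x → 0 ≤ r • x := fun r x hr hx =>
    smul_nonneg hr hx
  have hhalf : (1 / 2 : ℂ) • (a + u * a * star u) = (1 / 2 : ℝ) • (a + u * a * u) := by
    rw [hus, ← Complex.coe_smul]
    norm_num
  have hz : IsSelfAdjoint ((1 / 4 : ℝ) • (c + c - 1)) :=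
    (IsSelfAdjoint.all (1 / 4 : ℝ)).smul ((IsSelfAdjoint.add hcs hcs).sub (.one B))
  refine ⟨u, (1 / 4 : ℝ) • (c + c - 1), by rw [hus, huu], by rw [hus, huu], fun x => ?_, ?_, ?_⟩
  · simp only [smul_mul_assoc, mul_smul_comm, sub_mul, add_mul, mul_sub, mul_add, hcc, one_mul,
      mul_one]
  · refine (CStarAlgebra.norm_le_of_neg_le_of_le (r := 1 / 4) (by norm_num) hz ?_ ?_).trans
      (by norm_num)
    · rw [← sub_nonneg, Algebra.algebraMap_eq_smul_one]
      convert hsmul (1 / 2) (by norm_num) hc0 using 1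
      module
    · rw [← sub_nonneg, Algebra.algebraMap_eq_smul_one]
      convert hsmul (1 / 2) (by norm_num) hc1 using 1
      module
  · rw [hhalf]
    refine CStarAlgebra.norm_le_of_neg_le_of_le (by norm_num) (((IsSelfAdjoint.all (1 / 2 : ℝ)).smul hT).sub hz) ?_ ?_
    · rw [← sub_nonneg, Algebra.algebraMap_eq_smul_one]
      convert hsmul (1 / 2) (by norm_num) (sub_nonneg.mpr hlower) using 1
      module
    · rw [← sub_nonneg, Algebra.algebraMap_eq_smul_one]
      convert hsmul (1 / 2) (by norm_num) (sub_nonneg.mpr hupper) using 1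
      module

end Averaging

/-! ### Evaluating formulae -/

namespace CStarFormula

variable {A : Type*} [NonUnitalCStarAlgebra A] {n : ℕ}

instance nonempty_closedBall : Nonempty (Metric.closedBall (0 : A) 1) := ⟨⟨0, by simp⟩⟩

theorem bddAbove_range_eval (φ : CStarFormula (n + 1)) (v : Fin n → Metric.closedBall (0 : A) 1) :
    BddAbove (Set.range fun x : Metric.closedBall (0 : A) 1 =>
      φ.eval (Fin.snoc v x : Fin _ → Metric.closedBall (0 : A) 1)) := by
  obtain ⟨C, hC⟩ := φ.exists_forall_abs_eval_le
  exact ⟨C, by rintro _ ⟨x, rfl⟩; exact (abs_le.mp (hC A _)).2⟩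

theorem bddBelow_range_eval (φ : CStarFormula (n + 1)) (v : Fin n → Metric.closedBall (0 : A) 1) :
    BddBelow (Set.range fun x : Metric.closedBall (0 : A) 1 =>
      φ.eval (Fin.snoc v x : Fin _ → Metric.closedBall (0 : A) 1)) := by
  obtain ⟨C, hC⟩ := φ.exists_forall_abs_eval_le
  exact ⟨-C, by rintro _ ⟨x, rfl⟩; exact (abs_le.mp (hC A _)).1⟩

theorem eval_sup_le_iff {φ : CStarFormula (n + 1)} {v : Fin n → Metric.closedBall (0 : A) 1}
    {r : ℝ} : (sup φ).eval v ≤ r ↔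
      ∀ x : Metric.closedBall (0 : A) 1,
        φ.eval (Fin.snoc v x : Fin _ → Metric.closedBall (0 : A) 1) ≤ r :=
  ciSup_le_iff (bddAbove_range_eval φ v)

theorem eval_le_eval_sup (φ : CStarFormula (n + 1)) (v : Fin n → Metric.closedBall (0 : A) 1)
    (x : Metric.closedBall (0 : A) 1) :
    φ.eval (Fin.snoc v x : Fin _ → Metric.closedBall (0 : A) 1) ≤ (sup φ).eval v :=
  le_ciSup (bddAbove_range_eval φ v) x

theorem eval_inf_le (φ : CStarFormula (n + 1)) (v : Fin n → Metric.closedBall (0 : A) 1)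
    (x : Metric.closedBall (0 : A) 1) :
    (inf φ).eval v ≤ φ.eval (Fin.snoc v x : Fin _ → Metric.closedBall (0 : A) 1) :=
  ciInf_le (bddBelow_range_eval φ v) x

theorem exists_eval_lt_of_eval_inf_lt {φ : CStarFormula (n + 1)}
    {v : Fin n → Metric.closedBall (0 : A) 1} {r : ℝ} (h : (inf φ).eval v < r) :
    ∃ x : Metric.closedBall (0 : A) 1,
      φ.eval (Fin.snoc v x : Fin _ → Metric.closedBall (0 : A) 1) < r :=
  exists_lt_of_ciInf_lt h

theorem eval_sup_nonneg {φ : CStarFormula (n + 1)}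
    (h : ∀ v : Fin (n + 1) → Metric.closedBall (0 : A) 1, 0 ≤ φ.eval v)
    (v : Fin n → Metric.closedBall (0 : A) 1) : 0 ≤ (sup φ).eval v :=
  (h _).trans (eval_le_eval_sup φ v ⟨0, by simp⟩)

theorem eval_inf_nonneg {φ : CStarFormula (n + 1)}
    (h : ∀ v : Fin (n + 1) → Metric.closedBall (0 : A) 1, 0 ≤ φ.eval v)
    (v : Fin n → Metric.closedBall (0 : A) 1) : 0 ≤ (inf φ).eval v :=
  le_ciInf fun _ => h _

/-- The formula `max ‖s‖ ‖t‖`. -/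
def maxNorm (s t : StarPoly n) : CStarFormula n :=
  conn (k := 2) ⟨fun y => max (y 0) (y 1), by fun_prop⟩ ![norm s, norm t]

theorem eval_maxNorm (s t : StarPoly n) (v : Fin n → Metric.closedBall (0 : A) 1) :
    (maxNorm s t).eval v = max ‖s.eval fun i => (v i : A)‖ ‖t.eval fun i => (v i : A)‖ := rfl

/-- The formula `max φ (max ψ (‖t‖ - c))`. -/
def maxSub (φ ψ : CStarFormula n) (t : StarPoly n) (c : ℝ) : CStarFormula n :=
  conn (k := 3) ⟨fun y => max (y 0) (max (y 1) (y 2 - c)), by fun_prop⟩ ![φ, ψ, norm t]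

theorem eval_maxSub (φ ψ : CStarFormula n) (t : StarPoly n) (c : ℝ)
    (v : Fin n → Metric.closedBall (0 : A) 1) :
    (maxSub φ ψ t c).eval v =
      max (φ.eval v) (max (ψ.eval v) (‖t.eval fun i => (v i : A)‖ - c)) := rfl

end CStarFormula

/-- The `*`-polynomial `s - t`. -/
def StarPoly.sub {n : ℕ} (s t : StarPoly n) : StarPoly n := .add s (.smul (-1) t)

theorem StarPoly.eval_sub {A : Type*} [NonUnitalCStarAlgebra A] {n : ℕ} (s t : StarPoly n)
    (v : Fin n → A) : (s.sub t).eval v = s.eval v - t.eval v := by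
  simp [StarPoly.sub, StarPoly.eval, sub_eq_add_neg]

/-! ### Two sentences that vanish in finite-dimensional algebras -/

/-- The sentence `inf_e sup_x max ‖e x - x‖ ‖x e - x‖`, which measures how far the algebra is from
being unital. -/
def unitSentence : CStarSentence :=
  .inf (.sup (.maxNorm (.sub (.mul (.var 0) (.var 1)) (.var 1))
    (.sub (.mul (.var 1) (.var 0)) (.var 1))))

/-- The real part `(a + a*) / 2` as a `*`-polynomial. -/
noncomputable def StarPoly.re {n : ℕ} (t : StarPoly n) : StarPoly n :=
  .smul (1 / 2) (.add t (.adj t))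

/-- The quantifier-free part of `averagingSentence`, in the variables `a, u, z, x`. -/
noncomputable def averagingFormula : CStarFormula 4 :=
  .maxSub
    (.maxNorm (.sub (.mul (.mul (.adj (.var 1)) (.var 1)) (.var 3)) (.var 3))
      (.sub (.mul (.mul (.var 1) (.adj (.var 1))) (.var 3)) (.var 3)))
    (.norm (.sub (.mul (.var 2) (.var 3)) (.mul (.var 3) (.var 2))))
    (.sub (.smul (1 / 2) (.add (.re (.var 0))
      (.mul (.mul (.var 1) (.re (.var 0))) (.adj (.var 1))))) (.var 2)) (3 / 4)

/-- The sentence `sup_a inf_u inf_z sup_x` of `averagingFormula`. It vanishes if for every self-adjoint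
contraction `h` (written as the real part of `a`) there are a unitary `u` and a central contraction
`z` with `‖(h + u h u*) / 2 - z‖ ≤ 3 / 4`. As the language has no constant for the identity, the
unitarity of `u` is expressed through the action of `u* u` and `u u*` on all `x`. -/
noncomputable def averagingSentence : CStarSentence :=
  .sup (.inf (.inf (.sup averagingFormula)))

section

variable {A : Type*} [NonUnitalCStarAlgebra A]

theorem eval_averagingFormula (a u z x : Metric.closedBall (0 : A) 1) :
    averagingFormula.eval (Fin.snoc (α := fun _ => Metric.closedBall (0 : A) 1)
      (Fin.snoc (α := fun _ => Metric.closedBall (0 : A) 1)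
      (Fin.snoc (α := fun _ => Metric.closedBall (0 : A) 1)
      (Fin.snoc (α := fun _ => Metric.closedBall (0 : A) 1) Fin.elim0 a) u) z) x) =
    max (max ‖star (u : A) * u * x - x‖ ‖(u : A) * star (u : A) * x - x‖)
      (max ‖(z : A) * x - x * z‖
        (‖(1 / 2 : ℂ) • ((1 / 2 : ℂ) • ((a : A) + star (a : A)) +
          u * ((1 / 2 : ℂ) • ((a : A) + star (a : A))) * star (u : A)) - z‖ - 3 / 4)) := by
  simp only [averagingFormula, CStarFormula.eval_maxSub, CStarFormula.eval_maxNorm,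
    CStarFormula.eval, StarPoly.eval_sub]
  rfl

theorem averagingFormula_nonneg (v : Fin 4 → Metric.closedBall (0 : A) 1) :
    0 ≤ averagingFormula.eval v :=
  le_max_of_le_left (le_max_of_le_left (norm_nonneg _))

theorem value_unitSentence_eq_zero (F : Type*) [NonUnitalCStarAlgebra F]
    [FiniteDimensional ℂ F] : unitSentence.value F = 0 := by
  obtain ⟨e, he⟩ := NonUnitalCStarAlgebra.exists_unit_of_finiteDimensional F
  have hes : star e = e := by
    have h := congrArg star (he (star e)).1
    rwa [star_mul, star_star, (he (star e)).1] at h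
  have hn : ‖e‖ ≤ 1 := by
    have h := CStarRing.norm_star_mul_self (x := e)
    rw [hes, (he e).1] at h
    nlinarith [norm_nonneg e]
  refine le_antisymm ?_ (CStarFormula.eval_inf_nonneg (CStarFormula.eval_sup_nonneg fun v =>
    le_max_of_le_left (norm_nonneg _)) _)
  refine (CStarFormula.eval_inf_le _ _ ⟨e, mem_closedBall_zero_iff.mpr hn⟩).trans
    (CStarFormula.eval_sup_le_iff.mpr fun x => ?_)
  rw [CStarFormula.eval_maxNorm, StarPoly.eval_sub, StarPoly.eval_sub]
  change max ‖e * (x : F) - x‖ ‖(x : F) * e - x‖ ≤ 0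
  simp [he]

theorem value_averagingSentence_eq_zero (F : Type*) [NonUnitalCStarAlgebra F]
    [FiniteDimensional ℂ F] : averagingSentence.value F = 0 := by
  obtain ⟨e, he⟩ := NonUnitalCStarAlgebra.exists_unit_of_finiteDimensional F
  refine le_antisymm (CStarFormula.eval_sup_le_iff.mpr fun a => ?_)
    (CStarFormula.eval_sup_nonneg (CStarFormula.eval_inf_nonneg (CStarFormula.eval_inf_nonneg
      (CStarFormula.eval_sup_nonneg averagingFormula_nonneg))) _)
  have hsa : IsSelfAdjoint ((1 / 2 : ℂ) • ((a : F) + star (a : F))) := by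
    simp [isSelfAdjoint_iff, add_comm]
  have hn : ‖(1 / 2 : ℂ) • ((a : F) + star (a : F))‖ ≤ 1 := by
    have h1 : ‖(a : F)‖ ≤ 1 := mem_closedBall_zero_iff.mp a.2
    have h2 := norm_add_le (a : F) (star (a : F))
    rw [norm_star] at h2
    rw [norm_smul]
    norm_num
    linarith
  have key : ∃ u z : F, star u * u = e ∧ u * star u = e ∧ (∀ x, z * x = x * z) ∧ ‖z‖ ≤ 1 ∧
      ‖(1 / 2 : ℂ) • ((1 / 2 : ℂ) • ((a : F) + star (a : F)) +
          u * ((1 / 2 : ℂ) • ((a : F) + star (a : F))) * star (u : F)) - z‖ ≤ 3 / 4 := by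
    let i := CStarAlgebra.ofUnit e he
    exact @exists_unitary_central_norm_le F i ‹_› _ hsa hn
  obtain ⟨u, z, h1, h2, h3, h4, h5⟩ := key
  have hu : ‖u‖ ≤ 1 := by
    have hes : star e = e := by rw [← h1, star_mul, star_star]
    have h := CStarRing.norm_star_mul_self (x := e)
    rw [hes, (he e).1] at h
    have h' := CStarRing.norm_star_mul_self (x := u)
    rw [h1] at h'
    have : ‖e‖ ≤ 1 := by nlinarith [norm_nonneg e]
    nlinarith [norm_nonneg e, norm_nonneg u]
  refine (CStarFormula.eval_inf_le _ _ ⟨u, mem_closedBall_zero_iff.mpr hu⟩).trans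
    ((CStarFormula.eval_inf_le _ _ ⟨z, mem_closedBall_zero_iff.mpr h4⟩).trans
    (CStarFormula.eval_sup_le_iff.mpr fun x => ?_))
  rw [eval_averagingFormula]
  simp only [h1, h2, h3, he, sub_self, norm_zero, max_self, max_le_iff, le_refl, true_and]
  linarith

/-! ### Transfer to pseudocompact algebras -/

theorem IsPseudocompact.exists_approximate_unit (hA : IsPseudocompact A) {ε : ℝ} (hε : 0 < ε) :
    ∃ e : A, ‖e‖ ≤ 1 ∧ ∀ x : A, ‖x‖ ≤ 1 → ‖e * x - x‖ ≤ ε ∧ ‖x * e - x‖ ≤ ε := by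
  have h := hA unitSentence fun F _ _ => value_unitSentence_eq_zero F
  obtain ⟨e, he⟩ := CStarFormula.exists_eval_lt_of_eval_inf_lt (h.trans_lt hε)
  refine ⟨e, mem_closedBall_zero_iff.mp e.2, fun x hx => ?_⟩
  have := (CStarFormula.eval_le_eval_sup _ _ ⟨x, mem_closedBall_zero_iff.mpr hx⟩).trans he.le
  rw [CStarFormula.eval_maxNorm, StarPoly.eval_sub, StarPoly.eval_sub, max_le_iff] at this
  exact this

theorem IsPseudocompact.exists_approximate_averaging (hA : IsPseudocompact A) {h : A}
    (hs : IsSelfAdjoint h) (h1 : ‖h‖ ≤ 1) {ε : ℝ} (hε : 0 < ε) :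
    ∃ u z : A, ‖u‖ ≤ 1 ∧ (∀ x : A, ‖x‖ ≤ 1 → ‖star u * u * x - x‖ ≤ ε ∧
      ‖u * star u * x - x‖ ≤ ε ∧ ‖z * x - x * z‖ ≤ ε) ∧
      ‖(1 / 2 : ℂ) • (h + u * h * star u) - z‖ ≤ 3 / 4 + ε := by
  have hv := hA averagingSentence fun F _ _ => value_averagingSentence_eq_zero F
  have h2 := (CStarFormula.eval_le_eval_sup _ _ ⟨h, mem_closedBall_zero_iff.mpr h1⟩).trans hv.le
  obtain ⟨u, hu⟩ := CStarFormula.exists_eval_lt_of_eval_inf_lt (h2.trans_lt hε)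
  obtain ⟨z, hz⟩ := CStarFormula.exists_eval_lt_of_eval_inf_lt hu
  have key := fun x => (CStarFormula.eval_le_eval_sup _ _ x).trans hz.le
  -- the sentence speaks of the real part of `h`, which is `h` itself
  have hre : (1 / 2 : ℂ) • (h + star h) = h := by
    rw [hs.star_eq, ← two_smul ℂ h, smul_smul]
    norm_num
  simp only [eval_averagingFormula, hre, max_le_iff] at key
  refine ⟨u, z, mem_closedBall_zero_iff.mp u.2, fun x hx => ?_, ?_⟩
  · have := key ⟨x, mem_closedBall_zero_iff.mpr hx⟩
    exact ⟨this.1.1, this.1.2, this.2.1⟩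
  · linarith [(key ⟨0, by simp⟩).2.2]

theorem norm_le_mul_norm_of_forall_unitBall {E : Type*} [NormedAddCommGroup E] [NormedSpace ℂ E]
    {f : E → E} (hf : ∀ (c : ℂ) x, f (c • x) = c • f x) {ε : ℝ}
    (h : ∀ x, ‖x‖ ≤ 1 → ‖f x‖ ≤ ε) (x : E) : ‖f x‖ ≤ ε * ‖x‖ := by
  rcases eq_or_ne x 0 with rfl | hx
  · simpa using (congrArg norm (hf 0 0)).le
  · have hx' : 0 < ‖x‖ := norm_pos_iff.mpr hx
    have := h (((‖x‖⁻¹ : ℝ) : ℂ) • x) (by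
      rw [norm_smul, Complex.norm_of_nonneg (by positivity), inv_mul_cancel₀ hx'.ne'])
    rw [hf, norm_smul, Complex.norm_of_nonneg (by positivity)] at this
    rwa [inv_mul_le_iff₀ hx', mul_comm] at this

theorem IsPseudocompact.exists_unit (hA : IsPseudocompact A) :
    ∃ e : A, ∀ x : A, e * x = x ∧ x * e = x := by
  have hε : ∀ n : ℕ, (0 : ℝ) < (1 / 2) ^ n := fun n => by positivity
  choose s hs1 hs using fun n => hA.exists_approximate_unit (hε n)
  have hanti : ∀ {m n : ℕ}, m ≤ n → ((1 : ℝ) / 2) ^ n ≤ (1 / 2) ^ m := fun h =>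
    pow_le_pow_of_le_one (by norm_num) (by norm_num) h
  have h0 : Tendsto (fun n : ℕ => ((1 : ℝ) / 2) ^ n) atTop (𝓝 0) :=
    tendsto_pow_atTop_nhds_zero_of_lt_one (by norm_num) (by norm_num)
  have hcau : CauchySeq s := by
    refine cauchySeq_of_le_tendsto_0 (fun n => 2 * (1 / 2 : ℝ) ^ n) (fun n m N hn hm => ?_)
      (by simpa using h0.const_mul 2)
    calc dist (s n) (s m) ≤ dist (s n) (s n * s m) + dist (s n * s m) (s m) :=
          dist_triangle _ _ _
      _ ≤ (1 / 2) ^ m + (1 / 2) ^ n := by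
          rw [dist_comm, dist_eq_norm, dist_eq_norm]
          exact add_le_add (hs m _ (hs1 n)).2 (hs n _ (hs1 m)).1
      _ ≤ 2 * (1 / 2) ^ N := by linarith [hanti hn, hanti hm]
  obtain ⟨e, he⟩ := cauchySeq_tendsto_of_complete hcau
  refine ⟨e, fun x => ⟨?_, ?_⟩⟩
  · refine tendsto_nhds_unique (he.mul_const x) (tendsto_iff_norm_sub_tendsto_zero.mpr ?_)
    refine squeeze_zero (fun _ => norm_nonneg _) (fun n => ?_) (zero_mul ‖x‖ ▸ h0.mul_const ‖x‖)
    exact norm_le_mul_norm_of_forall_unitBall (f := fun z => s n * z - z)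
      (fun c z => by rw [mul_smul_comm, smul_sub]) (fun z hz => (hs n z hz).1) x
  · refine tendsto_nhds_unique (he.const_mul x) (tendsto_iff_norm_sub_tendsto_zero.mpr ?_)
    refine squeeze_zero (fun _ => norm_nonneg _) (fun n => ?_) (zero_mul ‖x‖ ▸ h0.mul_const ‖x‖)
    exact norm_le_mul_norm_of_forall_unitBall (f := fun z => z * s n - z)
      (fun c z => by rw [smul_mul_assoc, smul_sub]) (fun z hz => (hs n z hz).2) x

end

/-! ### Approximate unitaries -/

section Mixing

variable {A : Type*} [CStarAlgebra A]

/-- An approximate unitary is close to a unitary, namely to `v (v* v)^(-1/2)`. -/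
theorem exists_unitary_norm_sub_le {v : A} {δ : ℝ} (hδ : δ < 1) (h1 : ‖star v * v - 1‖ ≤ δ)
    (h2 : ‖v * star v - 1‖ ≤ δ) : ∃ u : unitary A, ‖v - u‖ ≤ δ := by
  let _ : PartialOrder A := CStarAlgebra.spectralOrder A
  have _ : StarOrderedRing A := CStarAlgebra.spectralOrderedRing A
  set h := star v * v with hh
  have hsa : IsSelfAdjoint h := IsSelfAdjoint.star_mul_self v
  have h0 : 0 ≤ h := star_mul_self_nonneg v
  have hunit : ∀ {x : A}, ‖x - 1‖ ≤ δ → IsUnit x := fun {x} hx => by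
    have := isUnit_one_sub_of_norm_lt_one (x := 1 - x) (by rw [norm_sub_rev]; linarith)
    simpa using this
  have hv : IsUnit v := by
    obtain ⟨b, hb⟩ := (hunit h1).exists_left_inv
    obtain ⟨c, hc⟩ := (hunit h2).exists_right_inv
    rw [hh, ← mul_assoc] at hb
    rw [mul_assoc] at hc
    exact isUnit_iff_exists_and_exists.mpr ⟨⟨_, hc⟩, ⟨_, hb⟩⟩
  have hpos : ∀ t ∈ spectrum ℝ h, 0 < t := fun t ht => by
    refine (spectrum_nonneg_of_nonneg h0 ht).lt_of_ne fun h00 => ?_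
    rw [← h00] at ht
    exact spectrum.zero_notMem ℝ (hunit h1) ht
  have hcs : ContinuousOn (fun t => √t) (spectrum ℝ h) := Real.continuous_sqrt.continuousOn
  have hcr : ContinuousOn (fun t => (√t)⁻¹) (spectrum ℝ h) :=
    hcs.inv₀ fun t ht => (Real.sqrt_pos.mpr (hpos t ht)).ne'
  have hid : cfc (fun t : ℝ => t) h = h := cfc_id' ℝ h hsa
  have hone : cfc (fun _ : ℝ => (1 : ℝ)) h = 1 := cfc_const_one ℝ h
  set r := cfc (fun t => (√t)⁻¹) h with hr
  set s := cfc (fun t => √t) h with hs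
  have hrs : r * s = 1 := by
    rw [hr, hs, ← cfc_mul _ _ h hcr hcs, ← hone]
    exact cfc_congr fun t ht => inv_mul_cancel₀ (Real.sqrt_pos.mpr (hpos t ht)).ne'
  have hsr : s * r = 1 := by
    rw [hr, hs, ← cfc_mul _ _ h hcs hcr, ← hone]
    exact cfc_congr fun t ht => mul_inv_cancel₀ (Real.sqrt_pos.mpr (hpos t ht)).ne'
  have hss : s * s = h := by
    rw [hs, ← cfc_mul _ _ h hcs hcs]
    exact (cfc_congr fun t ht => Real.mul_self_sqrt (hpos t ht).le).trans hid
  have hrstar : star r = r := cfc_predicate (p := IsSelfAdjoint) _ h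
  have hu1 : star (v * r) * (v * r) = 1 := by
    calc star (v * r) * (v * r) = r * h * r := by rw [star_mul, hrstar, hh]; simp only [mul_assoc]
      _ = (r * s) * (s * r) := by rw [← hss]; simp only [mul_assoc]
      _ = 1 := by rw [hrs, hsr, one_mul]
  have hu2 : (v * r) * star (v * r) = 1 := by
    have hru : IsUnit r := isUnit_iff_exists.mpr ⟨s, hrs, hsr⟩
    obtain ⟨c, hc⟩ := (hv.mul hru).exists_right_inv
    rwa [left_inv_eq_right_inv hu1 hc]
  refine ⟨⟨v * r, Unitary.mem_iff.mpr ⟨hu1, hu2⟩⟩, ?_⟩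
  have hδ0 : 0 ≤ δ := (norm_nonneg _).trans h1
  have hs1 : ‖s - 1‖ ≤ δ := by
    have hbound : ∀ t ∈ spectrum ℝ h, ‖t - 1‖ ≤ δ := by
      rw [← norm_cfc_le_iff (fun t : ℝ => t - 1) h hδ0 (by fun_prop) hsa,
        cfc_sub (fun t : ℝ => t) (fun _ => 1) h, hid, hone]
      exact h1
    rw [hs, ← hone, ← cfc_sub _ _ h hcs]
    refine norm_cfc_le hδ0 fun t ht => (?_ : ‖√t - 1‖ ≤ ‖t - 1‖).trans (hbound t ht)
    have hsq : t - 1 = (√t - 1) * (√t + 1) := by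
      linear_combination -(Real.mul_self_sqrt (hpos t ht).le)
    rw [hsq, norm_mul]
    refine le_mul_of_one_le_right (norm_nonneg _) ?_
    rw [Real.norm_eq_abs]
    exact (by linarith [Real.sqrt_nonneg t] : (1 : ℝ) ≤ √t + 1).trans (le_abs_self _)
  have heq : v - v * r = v * r * (s - 1) := by
    rw [mul_sub, mul_assoc v r s, hrs, mul_one, mul_one]
  have := CStarRing.norm_coe_unitary_mul ⟨v * r, Unitary.mem_iff.mpr ⟨hu1, hu2⟩⟩ (s - 1)
  change ‖v - v * r‖ ≤ δ
  rw [heq]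
  exact this.trans_le hs1

/-! ### Mixing operators -/

/-- The average `x ↦ (x + u x u*) / 2` of the identity and of conjugation by the unitary `u`. -/
noncomputable def mix (u : unitary A) : Module.End ℂ A :=
  (1 / 2 : ℂ) • (LinearMap.id + LinearMap.mulLeft ℂ (u : A) ∘ₗ LinearMap.mulRight ℂ (star (u : A)))

theorem mix_apply (u : unitary A) (x : A) :
    mix u x = (1 / 2 : ℂ) • (x + u * x * star (u : A)) := by
  simp [mix, mul_assoc]

variable (A) in
/-- The mixing operators: finite compositions of the averages `mix u`. Each is an average of
`2 ^ k` conjugations by unitaries. -/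
noncomputable def mixing : Submonoid (Module.End ℂ A) := Submonoid.closure (Set.range mix)

theorem mix_mem_mixing (u : unitary A) : mix u ∈ mixing A :=
  Submonoid.subset_closure ⟨u, rfl⟩

/-- Convex unitarily invariant sets are stable under mixing operators. -/
theorem apply_mem_of_mem_mixing {C : Set A} (hC : Convex ℝ C)
    (hinv : ∀ (u : unitary A), ∀ x ∈ C, (u : A) * x * star (u : A) ∈ C)
    {T : Module.End ℂ A} (hT : T ∈ mixing A) : ∀ x ∈ C, T x ∈ C := by
  induction hT using Submonoid.closure_induction with
  | mem T hT =>
    obtain ⟨u, rfl⟩ := hT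
    intro x hx
    have : mix u x = (1 / 2 : ℝ) • x + (1 / 2 : ℝ) • ((u : A) * x * star (u : A)) := by
      rw [mix_apply, ← smul_add, ← Complex.coe_smul]
      norm_num
    rw [this]
    exact hC hx (hinv u x hx) (by norm_num) (by norm_num) (by norm_num)
  | one => exact fun x hx => hx
  | mul S T _ _ hS hT => exact fun x hx => hS _ (hT x hx)

theorem apply_mem_convexHull_of_mem_mixing {T : Module.End ℂ A} (hT : T ∈ mixing A) {a x : A}
    (hx : x ∈ convexHull ℝ (Set.range fun u : unitary A => (u : A) * a * star (u : A))) :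
    T x ∈ convexHull ℝ (Set.range fun u : unitary A => (u : A) * a * star (u : A)) := by
  refine apply_mem_of_mem_mixing (convex_convexHull ℝ _) (fun u y hy => ?_) hT x hx
  set L : A →ₗ[ℝ] A := LinearMap.mulLeft ℝ (u : A) ∘ₗ LinearMap.mulRight ℝ (star (u : A))
  have hL : ∀ y, (u : A) * y * star (u : A) = L y := fun y => by simp [L, mul_assoc]
  rw [hL]
  refine convexHull_min (t := L ⁻¹' _) ?_ ((convex_convexHull ℝ _).linear_preimage L) hy
  rintro _ ⟨w, rfl⟩
  refine subset_convexHull ℝ _ ⟨u * w, ?_⟩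
  simp [← hL, mul_assoc]

theorem self_mem_convexHull_orbit (a : A) :
    a ∈ convexHull ℝ (Set.range fun u : unitary A => (u : A) * a * star (u : A)) :=
  subset_convexHull ℝ _ ⟨1, by simp⟩

theorem isSelfAdjoint_apply_of_mem_mixing {T : Module.End ℂ A} (hT : T ∈ mixing A) {x : A}
    (hx : IsSelfAdjoint x) : IsSelfAdjoint (T x) := by
  refine apply_mem_of_mem_mixing (C := {x | IsSelfAdjoint x}) ?_ (fun u x hx => ?_) hT x hx
  · intro x hx y hy s t _ _ _
    exact ((IsSelfAdjoint.all s).smul hx).add ((IsSelfAdjoint.all t).smul hy)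
  · exact IsSelfAdjoint.conjugate hx (u : A)

/-! ### Almost central elements -/

/-- The elements `z` whose inner derivation `x ↦ z x - x z` has norm at most `ε`. -/
def almostCenter (A : Type*) [CStarAlgebra A] (ε : ℝ) : Set A :=
  {z | ∀ x, ‖z * x - x * z‖ ≤ ε * ‖x‖}

theorem add_mem_almostCenter {ε δ : ℝ} {y z : A} (hy : y ∈ almostCenter A ε)
    (hz : z ∈ almostCenter A δ) : y + z ∈ almostCenter A (ε + δ) := fun x => by
  calc ‖(y + z) * x - x * (y + z)‖ = ‖(y * x - x * y) + (z * x - x * z)‖ := by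
        congr 1; noncomm_ring
    _ ≤ (ε + δ) * ‖x‖ := by
        rw [add_mul]
        exact norm_add_le_of_le (hy x) (hz x)

theorem smul_mem_almostCenter {ε : ℝ} {z : A} (hz : z ∈ almostCenter A ε) (c : ℂ) :
    c • z ∈ almostCenter A (‖c‖ * ε) := fun x => by
  rw [smul_mul_assoc, mul_smul_comm, ← smul_sub, norm_smul, mul_assoc]
  exact mul_le_mul_of_nonneg_left (hz x) (norm_nonneg c)

theorem star_mem_almostCenter {ε : ℝ} {z : A} (hz : z ∈ almostCenter A ε) :
    star z ∈ almostCenter A ε := fun x => by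
  have := hz (star x)
  rw [← norm_star, norm_star x] at this
  rw [norm_sub_rev]
  simpa using this

theorem mem_almostCenter_two_mul_norm (z : A) : z ∈ almostCenter A (2 * ‖z‖) := fun x => by
  have h1 := norm_mul_le z x
  have h2 := norm_mul_le x z
  have h3 := norm_sub_le (z * x) (x * z)
  linarith

theorem apply_mem_almostCenter_of_mem_mixing {T : Module.End ℂ A} (hT : T ∈ mixing A) {ε : ℝ}
    {z : A} (hz : z ∈ almostCenter A ε) : T z ∈ almostCenter A ε := by
  refine apply_mem_of_mem_mixing ?_ (fun u y hy x => ?_) hT z hz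
  · intro y hy z hz s t hs ht hst
    have h1 := smul_mem_almostCenter hy s
    have h2 := smul_mem_almostCenter hz t
    have := add_mem_almostCenter h1 h2
    rw [Complex.norm_of_nonneg hs, Complex.norm_of_nonneg ht, ← add_mul, hst, one_mul] at this
    simpa using this
  · have hu1 : star (u : A) * u = 1 := Unitary.coe_star_mul_self u
    have hu2 : (u : A) * star (u : A) = 1 := Unitary.coe_mul_star_self u
    have hn : ∀ w : A, ‖(u : A) * w * star (u : A)‖ = ‖w‖ := fun w => by
      rw [← Unitary.coe_star, CStarRing.norm_mul_coe_unitary, CStarRing.norm_coe_unitary_mul]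
    have hn' : ‖star (u : A) * x * u‖ = ‖x‖ := by
      rw [← Unitary.coe_star, CStarRing.norm_mul_coe_unitary, CStarRing.norm_coe_unitary_mul]
    have := hy (star (u : A) * x * u)
    rw [hn', ← hn] at this
    convert this using 2
    rw [mul_sub, sub_mul]
    congr 1
    · simp only [mul_assoc, hu2, mul_one]
    · simp only [← mul_assoc, hu2, one_mul]

/-- The unitary orbit of an almost central element stays close to that element. This makes repeated
mixing converge. -/
theorem norm_apply_sub_le_of_mem_mixing {T : Module.End ℂ A} (hT : T ∈ mixing A) {ε : ℝ}
    (hε : 0 ≤ ε) {z : A} (hz : z ∈ almostCenter A ε) : ‖T z - z‖ ≤ ε := by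
  have hsub : convexHull ℝ (Set.range fun u : unitary A => (u : A) * z * star (u : A)) ⊆
      Metric.closedBall z ε := by
    refine convexHull_min ?_ (convex_closedBall z ε)
    rintro _ ⟨u, rfl⟩
    rw [mem_closedBall_iff_norm]
    have huu : (u : A) * star (u : A) = 1 := Unitary.coe_mul_star_self u
    have hu : ‖star (u : A)‖ ≤ 1 := by
      have h1 := CStarRing.norm_self_mul_star (x := (1 : A))
      have h2 := CStarRing.norm_self_mul_star (x := (u : A))
      rw [star_one, mul_one] at h1
      rw [huu] at h2
      rw [norm_star]
      have : ‖(1 : A)‖ ≤ 1 := by nlinarith [norm_nonneg (1 : A)]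
      nlinarith [norm_nonneg (u : A)]
    have heq : (u : A) * z * star (u : A) - z =
        u * (z * star (u : A) - star (u : A) * z) := by
      rw [mul_sub, ← mul_assoc, ← mul_assoc, huu, one_mul]
    change ‖(u : A) * z * star (u : A) - z‖ ≤ ε
    rw [heq, CStarRing.norm_coe_unitary_mul]
    exact (hz _).trans (mul_le_of_le_one_right hε hu)
  exact mem_closedBall_iff_norm.mp
    (hsub (apply_mem_convexHull_of_mem_mixing hT (self_mem_convexHull_orbit z)))

end Mixing

/-! ### Averaging in pseudocompact algebras -/

section Pseudocompact

variable {A : Type*} [CStarAlgebra A]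

/-- The averaging sentence in a pseudocompact algebra, with the approximate unitary replaced by a
unitary and the almost central element by its real part, at the cost of a constant worse than
`3 / 4`. -/
theorem IsPseudocompact.exists_mix_norm_sub_le_of_norm_le_one (hA : IsPseudocompact A) {h : A}
    (hs : IsSelfAdjoint h) (h1 : ‖h‖ ≤ 1) {ε : ℝ} (hε : 0 < ε) :
    ∃ (u : unitary A) (z : A), IsSelfAdjoint z ∧ z ∈ almostCenter A ε ∧
      ‖mix u h - z‖ ≤ 4 / 5 := by
  obtain ⟨δ, hδ0, hδε, hδ⟩ : ∃ δ : ℝ, 0 < δ ∧ δ ≤ ε ∧ δ ≤ 1 / 40 :=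
    ⟨min ε (1 / 40), by positivity, min_le_left _ _, min_le_right _ _⟩
  obtain ⟨v, z, hv, hx, hvz⟩ := hA.exists_approximate_averaging hs h1 hδ0
  have hone : ‖(1 : A)‖ ≤ 1 := by
    have h1 := CStarRing.norm_self_mul_star (x := (1 : A))
    rw [star_one, mul_one] at h1
    nlinarith [norm_nonneg (1 : A)]
  obtain ⟨hv1, hv2, -⟩ := hx 1 hone
  rw [mul_one] at hv1 hv2
  obtain ⟨u, hu⟩ := exists_unitary_norm_sub_le (by linarith) hv1 hv2
  have hz : z ∈ almostCenter A ε := fun x =>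
    (norm_le_mul_norm_of_forall_unitBall (f := fun x => z * x - x * z)
      (fun c x => by rw [mul_smul_comm, smul_mul_assoc, smul_sub]) (fun x hx' => (hx x hx').2.2)
      x).trans (mul_le_mul_of_nonneg_right hδε (norm_nonneg x))
  have hhalf : ‖(1 / 2 : ℂ)‖ = 1 / 2 := by norm_num
  have hmix : IsSelfAdjoint (mix u h) := isSelfAdjoint_apply_of_mem_mixing (mix_mem_mixing u) hs
  have hnorm : ‖mix u h - z‖ ≤ 4 / 5 := by
    have e1 : mix u h - z = ((1 / 2 : ℂ) • (h + v * h * star v) - z) -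
        (1 / 2 : ℂ) • ((v - u) * (h * star v) + u * (h * star (v - u))) := by
      rw [mix_apply, sub_sub, add_comm z, ← sub_sub, ← smul_sub, star_sub]
      congr 2
      noncomm_ring
    have e2 : ‖(v - u) * (h * star v)‖ ≤ δ := by
      refine (norm_mul_le _ _).trans ((mul_le_of_le_one_right (norm_nonneg _) ?_).trans hu)
      refine (norm_mul_le _ _).trans (mul_le_one₀ h1 (norm_nonneg _) ?_)
      rwa [norm_star]
    have e3 : ‖(u : A) * (h * star (v - u))‖ ≤ δ := by
      rw [CStarRing.norm_coe_unitary_mul]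
      refine (norm_mul_le _ _).trans ((mul_le_of_le_one_left (norm_nonneg _) h1).trans ?_)
      rwa [norm_star]
    have e4 : ‖(1 / 2 : ℂ) • ((v - u) * (h * star v) + u * (h * star (v - u)))‖ ≤ δ := by
      have := norm_add_le_of_le e2 e3
      rw [norm_smul, hhalf]
      linarith
    rw [e1]
    exact (norm_sub_le_of_le hvz e4).trans (by linarith)
  refine ⟨u, (1 / 2 : ℂ) • (z + star z), by simp [isSelfAdjoint_iff, add_comm], ?_, ?_⟩
  · convert smul_mem_almostCenter (add_mem_almostCenter hz (star_mem_almostCenter hz)) (1 / 2)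
      using 2
    rw [hhalf]
    ring
  · have e1 : mix u h - (1 / 2 : ℂ) • (z + star z) =
        (1 / 2 : ℂ) • ((mix u h - z) + star (mix u h - z)) := by
      rw [star_sub, hmix.star_eq]
      module
    rw [e1, norm_smul, hhalf]
    have := norm_add_le_of_le hnorm ((norm_star _).trans_le hnorm)
    linarith

theorem IsPseudocompact.exists_mix_norm_sub_le (hA : IsPseudocompact A) {h : A}
    (hs : IsSelfAdjoint h) {ε : ℝ} (hε : 0 < ε) :
    ∃ (u : unitary A) (z : A), IsSelfAdjoint z ∧ z ∈ almostCenter A ε ∧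
      ‖mix u h - z‖ ≤ 4 / 5 * ‖h‖ := by
  rcases eq_or_ne h 0 with rfl | h0
  · exact ⟨1, 0, .zero A, fun x => by simp; positivity, by simp⟩
  have hpos : 0 < ‖h‖ := norm_pos_iff.mpr h0
  obtain ⟨u, z, hz, hzc, hn⟩ := hA.exists_mix_norm_sub_le_of_norm_le_one
    (h := ((‖h‖⁻¹ : ℝ) : ℂ) • h) (ε := ε / ‖h‖)
    (by
      rw [isSelfAdjoint_iff, star_smul, hs.star_eq, RCLike.star_def, Complex.conj_ofReal])
    (by rw [norm_smul, Complex.norm_of_nonneg (by positivity), inv_mul_cancel₀ hpos.ne'])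
    (by positivity)
  refine ⟨u, ((‖h‖ : ℝ) : ℂ) • z, ?_, ?_, ?_⟩
  · rw [isSelfAdjoint_iff, star_smul, hz.star_eq, RCLike.star_def, Complex.conj_ofReal]
  · have := smul_mem_almostCenter hzc ((‖h‖ : ℝ) : ℂ)
    rwa [Complex.norm_of_nonneg hpos.le, mul_div_cancel₀ _ hpos.ne'] at this
  · have e1 : mix u h - ((‖h‖ : ℝ) : ℂ) • z =
        ((‖h‖ : ℝ) : ℂ) • (mix u (((‖h‖⁻¹ : ℝ) : ℂ) • h) - z) := by
      rw [map_smul, smul_sub, smul_smul, ← Complex.ofReal_mul, mul_inv_cancel₀ hpos.ne',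
        Complex.ofReal_one, one_smul]
    rw [e1, norm_smul, Complex.norm_of_nonneg hpos.le, mul_comm]
    exact mul_le_mul_of_nonneg_right hn hpos.le

/-- Iteration of the averaging step, applied each time to the difference between the current mixture
of `h` and an almost central element. -/
theorem IsPseudocompact.exists_mixing_norm_sub_le (hA : IsPseudocompact A) {h : A}
    (hs : IsSelfAdjoint h) (k : ℕ) : ∀ {ε : ℝ}, 0 < ε →
    ∃ T ∈ mixing A, ∃ z : A, IsSelfAdjoint z ∧ z ∈ almostCenter A ε ∧
      ‖T h - z‖ ≤ (4 / 5) ^ k * ‖h‖ := by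
  induction k with
  | zero =>
    exact fun {ε} hε => ⟨1, one_mem _, 0, .zero A, fun x => by simp; positivity, by simp⟩
  | succ k ih =>
    intro ε hε
    obtain ⟨T, hT, z, hz, hzc, hn⟩ := ih (half_pos hε)
    obtain ⟨u, y, hy, hyc, hn'⟩ := hA.exists_mix_norm_sub_le
      ((isSelfAdjoint_apply_of_mem_mixing hT hs).sub hz) (half_pos hε)
    have hu := mix_mem_mixing u
    refine ⟨mix u * T, mul_mem hu hT, mix u z + y,
      (isSelfAdjoint_apply_of_mem_mixing hu hz).add hy, ?_, ?_⟩
    · have := add_mem_almostCenter (apply_mem_almostCenter_of_mem_mixing hu hzc) hyc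
      rwa [add_halves] at this
    · have e1 : (mix u * T) h - (mix u z + y) = mix u (T h - z) - y := by
        rw [map_sub, Module.End.mul_apply, sub_sub]
      rw [e1, pow_succ']
      linarith

theorem IsPseudocompact.exists_mixing_mem_almostCenter_of_isSelfAdjoint (hA : IsPseudocompact A)
    {h : A} (hs : IsSelfAdjoint h) {ε : ℝ} (hε : 0 < ε) :
    ∃ T ∈ mixing A, T h ∈ almostCenter A ε := by
  have hlim : Tendsto (fun k : ℕ => 2 * ((4 / 5 : ℝ) ^ k * ‖h‖)) atTop (𝓝 0) := by
    have := (tendsto_pow_atTop_nhds_zero_of_lt_one (r := (4 / 5 : ℝ)) (by norm_num)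
      (by norm_num)).mul_const ‖h‖ |>.const_mul 2
    rwa [zero_mul, mul_zero] at this
  obtain ⟨k, hk⟩ := (hlim.eventually_lt_const (half_pos hε)).exists
  obtain ⟨T, hT, z, -, hzc, hn⟩ := hA.exists_mixing_norm_sub_le hs k (half_pos hε)
  refine ⟨T, hT, fun x => ?_⟩
  have := add_mem_almostCenter (mem_almostCenter_two_mul_norm (T h - z)) hzc x
  rw [sub_add_cancel] at this
  exact this.trans (mul_le_mul_of_nonneg_right (by linarith) (norm_nonneg x))

/-- The imaginary part is mixed after the real part, which remains almost central under mixing. -/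
theorem IsPseudocompact.exists_mixing_mem_almostCenter (hA : IsPseudocompact A) (a : A) {ε : ℝ}
    (hε : 0 < ε) : ∃ T ∈ mixing A, T a ∈ almostCenter A ε := by
  obtain ⟨S, hS, hSc⟩ := hA.exists_mixing_mem_almostCenter_of_isSelfAdjoint
    (realPart a).2 (half_pos hε)
  obtain ⟨T, hT, hTc⟩ := hA.exists_mixing_mem_almostCenter_of_isSelfAdjoint
    (isSelfAdjoint_apply_of_mem_mixing hS (imaginaryPart a).2) (half_pos hε)
  refine ⟨T * S, mul_mem hT hS, ?_⟩
  have := add_mem_almostCenter (apply_mem_almostCenter_of_mem_mixing hT hSc)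
    (smul_mem_almostCenter hTc Complex.I)
  rw [Complex.norm_I, one_mul, add_halves] at this
  convert this using 1
  conv_lhs => rw [← realPart_add_I_smul_imaginaryPart a]
  rw [map_add, map_smul]
  rfl

theorem IsPseudocompact.closure_convexHull_inter_center_nonempty (hA : IsPseudocompact A) (a : A) :
    (closure (convexHull ℝ (Set.range fun u : unitary A => (u : A) * a * star (u : A))) ∩
      Set.center A).Nonempty := by
  have hε : ∀ n : ℕ, (0 : ℝ) < (1 / 2) ^ n := fun n => by positivity
  choose T hT hTc using fun (n : ℕ) (y : A) => hA.exists_mixing_mem_almostCenter y (hε n)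
  -- each term is a mixture of the previous one, hence close to it, as the latter is almost central
  let s : ℕ → A := fun n => Nat.rec (T 0 a a) (fun n y => T (n + 1) y y) n
  have hs : ∀ n, s (n + 1) = T (n + 1) (s n) (s n) := fun n => rfl
  have hmem : ∀ n, s n ∈ convexHull ℝ
      (Set.range fun u : unitary A => (u : A) * a * star (u : A)) := fun n => by
    induction n with
    | zero => exact apply_mem_convexHull_of_mem_mixing (hT _ _) (self_mem_convexHull_orbit a)
    | succ n ih => exact apply_mem_convexHull_of_mem_mixing (hT _ _) ih
  have hcen : ∀ n, s n ∈ almostCenter A ((1 / 2) ^ n) := fun n => by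
    cases n with
    | zero => exact hTc 0 a
    | succ n => exact hTc (n + 1) (s n)
  have hcau : CauchySeq s := by
    refine cauchySeq_of_le_geometric (1 / 2) 1 (by norm_num) fun n => ?_
    rw [one_mul, dist_comm, dist_eq_norm, hs]
    exact norm_apply_sub_le_of_mem_mixing (hT _ _) (hε n).le (hcen n)
  obtain ⟨z, hz⟩ := cauchySeq_tendsto_of_complete hcau
  refine ⟨z, mem_closure_of_tendsto hz (.of_forall hmem), ?_⟩
  rw [Semigroup.mem_center_iff]
  intro x
  have h1 : Tendsto (fun n => s n * x - x * s n) atTop (𝓝 (z * x - x * z)) :=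
    (hz.mul_const x).sub (hz.const_mul x)
  have h0 : Tendsto (fun n : ℕ => ((1 : ℝ) / 2) ^ n * ‖x‖) atTop (𝓝 0) := by
    have := (tendsto_pow_atTop_nhds_zero_of_lt_one (r := (1 / 2 : ℝ)) (by norm_num)
      (by norm_num)).mul_const ‖x‖
    rwa [zero_mul] at this
  have h2 : Tendsto (fun n => s n * x - x * s n) atTop (𝓝 0) :=
    squeeze_zero_norm (fun n => hcen n x) h0
  exact (sub_eq_zero.mp (tendsto_nhds_unique h1 h2)).symm

end Pseudocompact

/-! ### The Dixmier property of pseudocompact algebras -/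

theorem proposition5p10 (A : Type*) [NonUnitalCStarAlgebra A] (hA : IsPseudocompact A) :
    DixmierProperty A := by
  obtain ⟨e, he⟩ := hA.exists_unit
  let i := CStarAlgebra.ofUnit e he
  exact (@dixmierProperty_iff A i).mpr
    (@IsPseudocompact.closure_convexHull_inter_center_nonempty A i hA)
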